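/- **Theorem 3.4.** Let $p$ be an odd prime. For rational numbers $a,b$, write $a\equiv b\pmod{p^2}$ if $a-b=p^2c$ for some rational number $c$ whose denominator is not divisible by $p$. Then (i) if $p\equiv 3\pmod 4$, then $$\sum_{k=0}^{(p-1)/2}\frac{\binom{2k}{k}^3}{(-512)^k}\equiv 0\pmod{p^2};$$ (ii) if $p\equiv 5$ or $7\pmod 8$, then $$\sum_{k=0}^{(p-1)/2}\frac{\binom{2k}{k}^3}{(-64)^k}\equiv 0\pmod{p^2};$$ (iii) if $p\equiv 2\pmod 3$, then $$\sum_{k=0}^{(p-1)/2}\frac{\binom{2k}{k}^3}{16^k}\equiv \sum_{k=0}^{(p-1)/2}\frac{\binom{2k}{k}^3}{256^k}\equiv 0\pmod{p^2}.$$ -/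

import Mathlib

/-- Congruence of rational numbers modulo `n`: the difference `a - b` lies in `n * R`, where `R` is
the ring of rational numbers whose denominator is coprime to `n`. For `n = p ^ 2` with `p` prime,
`R` is the ring of rational `p`-integers. -/
def RatModEq (n : ℕ) (a b : ℚ) : Prop :=
  ∃ c : ℚ, c.den.Coprime n ∧ a - b = (n : ℚ) * c

/-!
Write `n = (p - 1) / 2` and let `L` be the shifted Legendre polynomial of degree `n`, whose
classical argument is `t = 1 - 2 x`. Modulo `p ^ 2` the binomial coefficient `(2k choose k)` equals
`(-16) ^ k * (n + k choose 2k)`, because `4 (n + k + 1) (n - k) = p ^ 2 - (2 k + 1) ^ 2`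
(`sixteen_pow_mul_choose`). This turns `∑ k, (2k choose k) ^ 3 / m ^ k` into
`∑ k, (2k choose k) ^ 2 * (n + k choose 2k) * (-16 / m) ^ k`, which by Clausen's identity
(`shiftedLegendre_sq`) is the square of the value of `L` at a point with `x ^ 2 - x = -16 / m`. That
point may be irrational, but the parity of `L` in `t` shows that the sum is `u ^ e * h (u) ^ 2` with
`u = t ^ 2 = 1 - 64 / m`, `e = n % 2` and a polynomial `h` over `ZMod (p ^ 2)`
(`exists_legendre_factor`). If `u` is a unit, vanishing modulo `p` therefore implies vanishing
modulo `p ^ 2` (`sq_dvd_sum_choose_cube`).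

Clausen's identity is proved by checking that both sides solve the symmetric square of the Legendre
equation, and that a polynomial solution is determined by its value at the origin.

Modulo `p` the sum becomes `∑ k, (n choose k) ^ 3 * w ^ k` with `w = -64 / m`, and `L` becomes
`∑ k, (n choose k) ^ 2 * x ^ k`. The symmetry of the binomial coefficients exchanges `w` and `w⁻¹`,
so that the values `w = 8`, `-4`, `1` remain to be treated.
* For `w = 8` one may take `x = -1`, and the alternating sum of the squares of the binomial
  coefficients vanishes for odd `n`.
* For `w = -4` the point `x` is a root of `x ^ 2 - x + 1`, fixed by the composition of
  `x ↦ 1 - x` and `x ↦ x⁻¹`; comparing the two symmetries of `L` forces `L` to vanish there.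
* For `w = 1` the polynomial `∑ k, (n choose k) ^ 3 * V ^ k = (1 + V) ^ e * r (V) ^ 2` is
  palindromic. Its factor `r` is antipalindromic when `(-2) ^ n = -1` modulo `p`, that is, when `-2`
  is not a square, and then `r (1) = 0`.
-/

open Polynomial

/-! ### Clausen's identity for shifted Legendre polynomials -/

/-- The coefficients of the terminating hypergeometric series
`₃F₂(-n, n + 1, 1/2; 1, 1; -4 x)`, in the form in which they are visibly integers. -/
def clausenCoeff (n k : ℕ) : ℤ :=
  ((2 * k).choose k : ℤ) ^ 2 * ((n + k).choose (2 * k) : ℤ)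

lemma derivative_two_mul (f : ℤ[X]) : derivative (2 * f) = 2 * derivative f := by
  simp [derivative_mul]

lemma coeff_X_mul_derivative (f : ℤ[X]) (j : ℕ) :
    (X * derivative f).coeff j = j * f.coeff j := by
  rcases j with _ | j
  · simp
  · rw [coeff_X_mul, coeff_derivative]; push_cast; ring

lemma choose_add_two_mul_succ (n k : ℕ) :
    ((2 * k + 1) * (2 * k + 2) * ((n + (k + 1)).choose (2 * (k + 1)) : ℤ)) =
      (n + k + 1) * (n - k) * ((n + k).choose (2 * k) : ℤ) := by
  rcases le_or_gt k n with h | h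
  · have h1 := Nat.add_one_mul_choose_eq (n + k) (2 * k)
    have h2 := Nat.choose_succ_right_eq (n + k + 1) (2 * k + 1)
    rw [show n + k + 1 - (2 * k + 1) = n - k by omega] at h2
    zify [h] at h1 h2
    rw [show n + (k + 1) = n + k + 1 by ring, show 2 * (k + 1) = 2 * k + 1 + 1 by ring]
    linear_combination (2 * (k : ℤ) + 1) * h2 - ((n : ℤ) - k) * h1
  · rw [Nat.choose_eq_zero_of_lt (by omega), Nat.choose_eq_zero_of_lt (by omega)]
    simp

lemma succ_mul_choose_two_mul_succ (k : ℕ) :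
    ((k : ℤ) + 1) * ((2 * (k + 1)).choose (k + 1) : ℤ) =
      2 * (2 * k + 1) * ((2 * k).choose k : ℤ) := by
  have := Nat.succ_mul_centralBinom_succ k
  simp only [Nat.centralBinom_eq_two_mul_choose] at this
  exact_mod_cast this

lemma clausenCoeff_succ (n k : ℕ) :
    ((k : ℤ) + 1) ^ 3 * clausenCoeff n (k + 1) =
      2 * (2 * k + 1) * (n * (n + 1) - k * (k + 1)) * clausenCoeff n k := by
  have h1 := choose_add_two_mul_succ n k
  have h2 := succ_mul_choose_two_mul_succ k
  unfold clausenCoeff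
  have hk : ((2 * k + 1) * (2 : ℤ)) ≠ 0 := by positivity
  apply mul_left_cancel₀ hk
  set a := ((2 * (k + 1)).choose (k + 1) : ℤ)
  set b := ((2 * k).choose k : ℤ)
  set c := ((n + (k + 1)).choose (2 * (k + 1)) : ℤ)
  set d := ((n + k).choose (2 * k) : ℤ)
  linear_combination ((k + 1) * a) ^ 2 * h1 +
    ((n + k + 1) * (n - k) * d) * ((k + 1) * a + 2 * (2 * k + 1) * b) * h2

lemma coeff_shiftedLegendre_succ (n k : ℕ) :
    ((k : ℤ) + 1) ^ 2 * (shiftedLegendre n).coeff (k + 1) =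
      (k * (k + 1) - n * (n + 1)) * (shiftedLegendre n).coeff k := by
  simp only [coeff_shiftedLegendre]
  have h1 : ((n.choose (k + 1) : ℤ)) * (k + 1) = n.choose k * (n - k) := by
    rcases le_or_gt k n with h | h
    · have := Nat.choose_succ_right_eq n k
      zify [h] at this
      exact this
    · rw [Nat.choose_eq_zero_of_lt (by omega), Nat.choose_eq_zero_of_lt h]
      simp
  have h2 : ((n + (k + 1)).choose n : ℤ) * (k + 1) = (n + k).choose n * (n + k + 1) := by
    have := Nat.choose_mul_succ_eq (n + k) n
    rw [show n + k + 1 - n = k + 1 by omega] at this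
    zify at this
    exact this.symm
  rw [pow_succ (-1 : ℤ) k]
  set a := (n.choose (k + 1) : ℤ)
  set b := (n.choose k : ℤ)
  set c := ((n + (k + 1)).choose n : ℤ)
  set d := ((n + k).choose n : ℤ)
  linear_combination (-(-1) ^ k * (k + 1) * c) * h1 - ((-1) ^ k * b * (n - k)) * h2

/-- The Legendre differential equation, in self-adjoint form. -/
lemma shiftedLegendre_ode (n : ℕ) :
    derivative ((X ^ 2 - X) * derivative (shiftedLegendre n)) =
      C ((n : ℤ) * (n + 1)) * shiftedLegendre n := by
  ext k
  have h := coeff_shiftedLegendre_succ n k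
  have e : (X ^ 2 - X) * derivative (shiftedLegendre n) =
      X * (X * derivative (shiftedLegendre n)) - X * derivative (shiftedLegendre n) := by ring
  rw [e, coeff_derivative, coeff_sub, coeff_X_mul, coeff_X_mul, coeff_C_mul]
  rcases k with _ | k
  · simp [coeff_derivative] at h ⊢
    linear_combination -h
  · rw [coeff_X_mul, coeff_derivative, coeff_derivative]
    push_cast at h ⊢
    linear_combination -h

/-- The symmetric square of the Legendre equation, satisfied by the square of a solution. -/
lemma symmSquare_ode_sq {N : ℤ} {y : ℤ[X]}
    (hy : derivative ((X ^ 2 - X) * derivative y) = C N * y) :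
    derivative ((X ^ 2 - X) *
        (derivative ((X ^ 2 - X) * derivative (y ^ 2)) - C (2 * N) * y ^ 2)) =
      C (2 * N) * (X ^ 2 - X) * derivative (y ^ 2) := by
  have h1 : derivative ((X ^ 2 - X) * derivative (y ^ 2)) =
      2 * (derivative y * ((X ^ 2 - X) * derivative y) + y * (C N * y)) := by
    rw [← hy, ← derivative_mul,
      show (X ^ 2 - X) * derivative (y ^ 2) = 2 * (y * ((X ^ 2 - X) * derivative y)) by
        rw [derivative_sq, show (C (2 : ℤ)) = 2 from rfl]; ring, derivative_two_mul]
  have h2 : (X ^ 2 - X) *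
      (derivative ((X ^ 2 - X) * derivative (y ^ 2)) - C (2 * N) * y ^ 2) =
      2 * ((X ^ 2 - X) * derivative y) ^ 2 := by
    rw [h1, C_mul, show (C (2 : ℤ)) = 2 from rfl]; ring
  rw [h2, derivative_two_mul, derivative_sq, hy, derivative_sq, C_mul,
    show (C (2 : ℤ)) = 2 from rfl]
  ring

/-- The origin is a singular point of the symmetric square equation with triple exponent `0`,
so a polynomial solution is determined by its value there. -/
lemma symmSquare_ode_unique {N : ℤ} {z : ℤ[X]} (h0 : z.coeff 0 = 0)
    (hz : derivative ((X ^ 2 - X) * (derivative ((X ^ 2 - X) * derivative z) - C (2 * N) * z)) =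
      C (2 * N) * (X ^ 2 - X) * derivative z) : z = 0 := by
  have hs (f : ℤ[X]) : (X ^ 2 - X) * f = X * (X * f) - X * f := by ring
  set M := derivative ((X ^ 2 - X) * derivative z) - C (2 * N) * z with hM
  have hM' (k : ℕ) : M.coeff k =
      (k + 1) * (k * z.coeff k - (k + 1) * z.coeff (k + 1)) - 2 * N * z.coeff k := by
    rw [hM, hs, coeff_sub, coeff_derivative, coeff_sub, coeff_X_mul, coeff_X_mul_derivative,
      coeff_X_mul_derivative, coeff_C_mul]
    push_cast
    ring
  rw [mul_assoc (C (2 * N)), hs, hs] at hz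
  have key (k : ℕ) := congrArg (fun f ↦ f.coeff k) hz
  simp only [coeff_derivative, coeff_sub, coeff_C_mul, coeff_X_mul_derivative] at key
  have step (k : ℕ) : z.coeff k = 0 ∧ z.coeff (k + 1) = 0 := by
    induction k with
    | zero =>
      refine ⟨h0, ?_⟩
      have := key 0
      rw [coeff_X_mul, coeff_X_mul, hM', mul_coeff_zero, mul_coeff_zero, coeff_X_zero] at this
      simpa [h0] using this
    | succ k ih =>
      refine ⟨ih.2, ?_⟩
      have := key (k + 1)
      rw [coeff_X_mul (X * M), coeff_X_mul M, coeff_X_mul M, coeff_X_mul (X * derivative z),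
        coeff_X_mul_derivative, hM', hM', ih.1, ih.2] at this
      have h3 : ((k : ℤ) + 2) ^ 3 * z.coeff (k + 2) = 0 := by
        push_cast at this
        linear_combination this
      exact (mul_eq_zero.1 h3).resolve_left (by positivity)
  ext k
  simpa using (step k).1

/-- The generating polynomial of `clausenCoeff n`; the coefficients with index `k > n` vanish. -/
noncomputable def clausenPoly (n : ℕ) : ℤ[X] :=
  ∑ k ∈ Finset.range (n + 1), C (clausenCoeff n k) * X ^ k

lemma coeff_clausenPoly (n k : ℕ) : (clausenPoly n).coeff k = clausenCoeff n k := by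
  rw [clausenPoly, finsetSum_coeff]
  simp_rw [coeff_C_mul_X_pow]
  simp +contextual [clausenCoeff]
  intro h
  right
  exact Nat.choose_eq_zero_of_lt (by omega)

lemma clausenPoly_ode (n : ℕ) :
    derivative (X * ((1 + 4 * X) * derivative (X * derivative (clausenPoly n)) +
        2 * (X * derivative (clausenPoly n)) - C (2 * (n * (n + 1) : ℤ)) * clausenPoly n)) =
      C (2 * (n * (n + 1) : ℤ)) * (X * derivative (clausenPoly n)) := by
  have e (f : ℤ[X]) : (1 + 4 * X) * f = f + C 4 * (X * f) := by
    rw [show (C (4 : ℤ)) = 4 from rfl]; ring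
  ext k
  have h := clausenCoeff_succ n k
  rw [coeff_derivative, coeff_X_mul, e, coeff_sub, coeff_add, coeff_add, coeff_C_mul, coeff_C_mul,
    coeff_C_mul, coeff_ofNat_mul, coeff_X_mul_derivative, coeff_derivative,
    coeff_X_mul_derivative,
    coeff_X_mul_derivative]
  rw [coeff_clausenPoly, coeff_clausenPoly]
  push_cast
  linear_combination h

/-- Substituting `x ^ 2 - x` turns the equation of `clausenPoly` into the symmetric square of the
Legendre equation. -/
lemma symmSquare_ode_clausenPoly_comp (n : ℕ) :
    derivative ((X ^ 2 - X) * (derivative ((X ^ 2 - X) *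
        derivative ((clausenPoly n).comp (X ^ 2 - X))) -
        C (2 * (n * (n + 1) : ℤ)) * (clausenPoly n).comp (X ^ 2 - X))) =
      C (2 * (n * (n + 1) : ℤ)) * (X ^ 2 - X) *
        derivative ((clausenPoly n).comp (X ^ 2 - X)) := by
  set F := clausenPoly n
  set s : ℤ[X] := X ^ 2 - X
  have hs : derivative s = 2 * X - 1 := by
    simp only [s, derivative_sub, derivative_X_pow, derivative_X]
    simp
  have h1 : s * derivative (F.comp s) = (2 * X - 1) * (X * derivative F).comp s := by
    rw [derivative_comp, hs, mul_comp, X_comp]; ring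
  have h2 : derivative (s * derivative (F.comp s)) - C (2 * (n * (n + 1) : ℤ)) * F.comp s =
      ((1 + 4 * X) * derivative (X * derivative F) + 2 * (X * derivative F) -
        C (2 * (n * (n + 1) : ℤ)) * F).comp s := by
    rw [h1, derivative_mul, derivative_comp, hs]
    simp only [add_comp, sub_comp, mul_comp, one_comp, ofNat_comp, X_comp, C_comp,
      derivative_sub, derivative_one, derivative_two_mul, derivative_X]
    simp only [s]
    ring
  rw [h2]
  have h3 := congrArg (fun f ↦ derivative s * f.comp s) (clausenPoly_ode n)
  rw [← derivative_comp, mul_comp X, X_comp] at h3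
  rw [h3, hs, mul_assoc, h1, mul_comp, C_comp]
  ring

/-- **Clausen's identity** for Legendre polynomials. -/
theorem shiftedLegendre_sq (n : ℕ) :
    shiftedLegendre n ^ 2 = (clausenPoly n).comp (X ^ 2 - X) := by
  rw [← sub_eq_zero]
  apply symmSquare_ode_unique (N := n * (n + 1))
  · rw [coeff_zero_eq_eval_zero, eval_sub, eval_pow, eval_comp, ← coeff_zero_eq_eval_zero]
    simp [← coeff_zero_eq_eval_zero, coeff_shiftedLegendre, coeff_clausenPoly, clausenCoeff]
  · have h1 := symmSquare_ode_sq (shiftedLegendre_ode n)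
    have h2 := symmSquare_ode_clausenPoly_comp n
    simp only [derivative_sub, mul_sub] at h1 h2 ⊢
    linear_combination h1 - h2

/-! ### Parity -/

/-- A polynomial of definite parity is, up to a factor `X`, a polynomial in `X ^ 2`. -/
lemma exists_eq_X_pow_mul_expand {R : Type*} [CommRing R] (h2 : IsUnit (2 : R)) (n : ℕ) {g : R[X]}
    (hg : (-1) ^ n * g.comp (-X) = g) : ∃ h : R[X], g = X ^ (n % 2) * expand R 2 h := by
  have hc (j : ℕ) (hj : (n + j) % 2 = 1) : g.coeff j = 0 := by
    have h := congrArg (fun f ↦ f.coeff j) hg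
    have e : (-1) ^ n * g.comp (-X) = C ((-1) ^ n) * g.comp (C (-1) * X) := by simp
    rw [e, coeff_C_mul, comp_C_mul_X_coeff, mul_comm (g.coeff j), ← mul_assoc, ← pow_add,
      (Nat.odd_iff.2 hj).neg_one_pow] at h
    apply h2.mul_left_cancel
    linear_combination -h
  rcases Nat.mod_two_eq_zero_or_one n with hn | hn
  · refine ⟨contract 2 g, ?_⟩
    ext j
    rw [hn, pow_zero, one_mul, coeff_expand two_pos, coeff_contract two_ne_zero]
    split_ifs with hj
    · rw [Nat.div_mul_cancel hj]
    · exact hc j (by omega)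
  · refine ⟨contract 2 (divX g), ?_⟩
    rw [hn, pow_one]
    ext j
    rcases j with _ | j
    · rw [coeff_X_mul_zero]; exact hc 0 (by omega)
    · rw [coeff_X_mul, coeff_expand two_pos, coeff_contract two_ne_zero]
      split_ifs with hj
      · rw [Nat.div_mul_cancel hj, coeff_divX]
      · exact hc _ (by omega)

/-- In terms of the classical argument `t = 1 - 2 x`, the `n`-th Legendre polynomial is
`t ^ (n % 2) * h (t ^ 2)`. Since `x ^ 2 - x = (t ^ 2 - 1) / 4`, Clausen's identity then becomes an
identity of polynomials in `u = t ^ 2`. -/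
lemma exists_legendre_factor {R : Type*} [CommRing R] {a : R} (ha : 2 * a = 1) (n : ℕ) :
    ∃ h : R[X],
      ((shiftedLegendre n).map (Int.castRingHom R)).comp (C a * (1 - X)) =
        X ^ (n % 2) * expand R 2 h ∧
      ((clausenPoly n).map (Int.castRingHom R)).comp (C (a ^ 2) * (X - 1)) =
        X ^ (n % 2) * h ^ 2 := by
  have ha' : (2 : R[X]) * C a = 1 := by
    rw [show (2 : R[X]) = C 2 from rfl, ← C_mul, ha, C_1]
  set L := (shiftedLegendre n).map (Int.castRingHom R) with hL
  have hsymm : (-1) ^ n * L.comp (1 - X) = L := by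
    have := congrArg (Polynomial.map (Int.castRingHom R))
      (neg_one_pow_mul_shiftedLegendre_comp_one_sub_X_eq n)
    simpa [map_comp] using this
  have hpar : (-1) ^ n * (L.comp (C a * (1 - X))).comp (-X) = L.comp (C a * (1 - X)) := by
    conv_rhs => rw [← hsymm]
    rw [mul_comp, comp_assoc, comp_assoc]
    congr 1
    · simp
    · congr 1
      simp only [mul_comp, sub_comp, C_comp, one_comp, X_comp]
      linear_combination ha'
  obtain ⟨h, hh⟩ := exists_eq_X_pow_mul_expand (IsUnit.of_mul_eq_one a ha) n hpar
  refine ⟨h, hh, ?_⟩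
  apply expand_injective (R := R) two_pos
  have hcl : L ^ 2 = ((clausenPoly n).map (Int.castRingHom R)).comp (X ^ 2 - X) := by
    have := congrArg (Polynomial.map (Int.castRingHom R)) (shiftedLegendre_sq n)
    simpa [map_comp] using this
  have hcl' := congrArg (fun f ↦ f.comp (C a * (1 - X))) hcl
  rw [pow_comp, hh, comp_assoc] at hcl'
  rw [show expand R 2 (X ^ (n % 2) * h ^ 2) = (X ^ (n % 2) * expand R 2 h) ^ 2 by
    simp only [map_mul, map_pow, expand_X]; ring, hcl', expand_eq_comp_X_pow, comp_assoc]
  congr 1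
  simp only [mul_comp, sub_comp, C_comp, one_comp, X_comp, pow_comp, C_pow]
  linear_combination (-(C a) * (1 - X)) * ha'

/-! ### Reduction modulo `p` -/

/-- The sum `∑ k, (n choose k) ^ m * w ^ k`. The point `w` is allowed to be an element of any
commutative semiring, in particular the variable of a polynomial ring. -/
def choosePowSum {R : Type*} [CommSemiring R] (m n : ℕ) (w : R) : R :=
  ∑ k ∈ Finset.range (n + 1), (n.choose k : R) ^ m * w ^ k

lemma map_choosePowSum {R S : Type*} [CommSemiring R] [CommSemiring S] (f : R →+* S) (m n : ℕ)
    (w : R) : f (choosePowSum m n w) = choosePowSum m n (f w) := by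
  simp [choosePowSum]

/-- The symmetry of the binomial coefficients. -/
lemma pow_mul_choosePowSum {R : Type*} [CommSemiring R] {m n : ℕ} {w v : R} (h : w * v = 1) :
    w ^ n * choosePowSum m n v = choosePowSum m n w := by
  unfold choosePowSum
  rw [Finset.mul_sum, ← Finset.sum_range_reflect]
  refine Finset.sum_congr rfl fun k hk ↦ ?_
  have hk : k ≤ n := Nat.lt_succ_iff.1 (Finset.mem_range.1 hk)
  rw [show n + 1 - 1 - k = n - k by omega, Nat.choose_symm hk]
  calc w ^ n * ((n.choose k : R) ^ m * v ^ (n - k))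
      = (n.choose k : R) ^ m * w ^ k * (w ^ (n - k) * v ^ (n - k)) := by
        nth_rw 1 [← Nat.add_sub_cancel' hk]; rw [pow_add]; ring
    _ = (n.choose k : R) ^ m * w ^ k := by rw [← mul_pow, h, one_pow, mul_one]

section

variable {K : Type*} [Field K] {p n : ℕ} [CharP K p]

lemma natCast_succ_ne_zero_of_lt {k : ℕ} (h : k + 1 < p) : (k : K) + 1 ≠ 0 := by
  rw [← Nat.cast_add_one, Ne, CharP.cast_eq_zero_iff K p]
  exact fun hd ↦ absurd (Nat.le_of_dvd k.succ_pos hd) (by omega)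

lemma two_mul_add_one_eq_zero (hn : 2 * n + 1 = p) : 2 * (n : K) + 1 = 0 := by
  have := CharP.cast_eq_zero K p
  rw [← hn] at this
  exact_mod_cast this

lemma choose_add_eq (hn : 2 * n + 1 = p) {k : ℕ} (hk : k ≤ n) :
    ((n + k).choose n : K) = (-1) ^ k * n.choose k := by
  induction k with
  | zero => simp
  | succ k ih =>
    have h1 := congrArg (Nat.cast (R := K)) (Nat.choose_mul_succ_eq (n + k) n)
    rw [show n + k + 1 - n = k + 1 by omega] at h1
    have h2 := congrArg (Nat.cast (R := K)) (Nat.choose_succ_right_eq n k)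
    push_cast [Nat.cast_sub (show k ≤ n by omega)] at h1 h2
    apply mul_right_cancel₀ (natCast_succ_ne_zero_of_lt (K := K) (p := p) (k := k) (by omega))
    rw [ih (by omega)] at h1
    rw [← add_assoc]
    linear_combination -h1 - (-1) ^ (k + 1) * h2 +
      (-1) ^ k * (n.choose k : K) * two_mul_add_one_eq_zero (K := K) hn

lemma clausenCoeff_eq (hn : 2 * n + 1 = p) {k : ℕ} (hk : k ≤ n) :
    (clausenCoeff n k : K) = 4 ^ k * (n.choose k : K) ^ 3 := by
  induction k with
  | zero => simp [clausenCoeff]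
  | succ k ih =>
    have h1 := congrArg (Int.cast (R := K)) (clausenCoeff_succ n k)
    have h2 := congrArg (Nat.cast (R := K)) (Nat.choose_succ_right_eq n k)
    push_cast [Nat.cast_sub (show k ≤ n by omega)] at h1 h2
    apply mul_left_cancel₀
      (pow_ne_zero 3 (natCast_succ_ne_zero_of_lt (K := K) (p := p) (k := k) (by omega)))
    rw [ih (by omega)] at h1
    have h3 := two_mul_add_one_eq_zero (K := K) hn
    -- since `n = -1 / 2`, both `k + 1 / 2` and `n + k + 1` may be replaced by `k - n`
    have h4 : 2 * (2 * (k : K) + 1) * (n * (n + 1) - k * (k + 1)) = 4 * ((n : K) - k) ^ 3 := by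
      linear_combination 2 * ((n : K) - k) * (2 * n + 1 - 3 * (n - k)) * h3
    have h5 : ((n.choose (k + 1) : K) * (k + 1)) ^ 3 = (n.choose k * ((n : K) - k)) ^ 3 := by
      rw [h2]
    rw [h4] at h1
    linear_combination h1 - 4 ^ (k + 1) * h5

lemma aeval_shiftedLegendre_eq (hn : 2 * n + 1 = p) (x : K) :
    aeval x (shiftedLegendre n) = choosePowSum 2 n x := by
  rw [shiftedLegendre, map_sum, choosePowSum]
  refine Finset.sum_congr rfl fun k hk ↦ ?_
  have := choose_add_eq (K := K) hn (Nat.lt_succ_iff.1 (Finset.mem_range.1 hk))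
  rw [map_mul, aeval_C, map_pow, aeval_X, algebraMap_int_eq, eq_intCast]
  push_cast
  rw [this]
  rw [show (-1 : K) ^ k * n.choose k * ((-1) ^ k * n.choose k) * x ^ k =
    ((-1) * (-1)) ^ k * ((n.choose k : K) ^ 2 * x ^ k) by rw [mul_pow]; ring]
  simp

lemma map_clausenPoly_comp (hn : 2 * n + 1 = p) {b : K} (hb : 4 * b = 1) (f : K[X]) :
    ((clausenPoly n).map (Int.castRingHom K)).comp (C b * f) = choosePowSum 3 n f := by
  rw [clausenPoly, Polynomial.map_sum, Polynomial.sum_comp, choosePowSum]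
  refine Finset.sum_congr rfl fun k hk ↦ ?_
  have := clausenCoeff_eq (K := K) hn (Nat.lt_succ_iff.1 (Finset.mem_range.1 hk))
  rw [Polynomial.map_mul, map_C, Polynomial.map_pow, map_X, mul_comp, C_comp, pow_comp, X_comp,
    eq_intCast, this, mul_pow, ← mul_assoc, ← C_pow, ← C_mul, mul_right_comm, ← mul_pow, hb,
    one_pow, one_mul]
  simp

/-- Clausen's identity modulo `p`. -/
lemma choosePowSum_three_eq_sq (hn : 2 * n + 1 = p) (x : K) :
    choosePowSum 3 n (4 * (x ^ 2 - x)) = choosePowSum 2 n x ^ 2 := by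
  rw [← aeval_shiftedLegendre_eq hn, ← map_pow, shiftedLegendre_sq, aeval_comp, clausenPoly,
    map_sum, choosePowSum]
  refine Finset.sum_congr rfl fun k hk ↦ ?_
  have := clausenCoeff_eq (K := K) hn (Nat.lt_succ_iff.1 (Finset.mem_range.1 hk))
  rw [map_mul, aeval_C, map_pow, aeval_X, algebraMap_int_eq, eq_intCast, this, map_sub, map_pow,
    aeval_X, mul_pow]
  ring

/-- Invariance of the Legendre polynomial under `x ↦ 1 - x`. -/
lemma choosePowSum_two_one_sub (hn : 2 * n + 1 = p) (x : K) :
    choosePowSum 2 n x = (-1) ^ n * choosePowSum 2 n (1 - x) := by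
  rw [← aeval_shiftedLegendre_eq hn, ← aeval_shiftedLegendre_eq hn, shiftedLegendre_eval_symm]

end

/-! ### Vanishing modulo `p` at the supersingular arguments -/

section

variable {K : Type*} [Field K] {p n : ℕ} [CharP K p]

lemma two_ne_zero_of_two_mul_add_one_eq (hn : 2 * n + 1 = p) : (2 : K) ≠ 0 := by
  intro h
  have := two_mul_add_one_eq_zero (K := K) hn
  rw [h] at this
  simp at this

/-- Here the underlying Legendre polynomial is evaluated at the point `x = -1`, and
`∑ k, (-1) ^ k * (n choose k) ^ 2` vanishes for odd `n`. -/
lemma choosePowSum_three_eight (hn : 2 * n + 1 = p) (hodd : Odd n) :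
    choosePowSum 3 n (8 : K) = 0 := by
  have h1 := pow_mul_choosePowSum (m := 2) (n := n) (show (-1 : K) * -1 = 1 by norm_num)
  rw [hodd.neg_one_pow] at h1
  have h2 : choosePowSum 2 n (-1 : K) = 0 := by
    apply (mul_eq_zero.1 (_ : (2 : K) * _ = 0)).resolve_left
      (two_ne_zero_of_two_mul_add_one_eq hn)
    linear_combination -h1
  have h3 := choosePowSum_three_eq_sq hn (-1 : K)
  rw [h2, show (4 : K) * ((-1) ^ 2 - -1) = 8 by norm_num] at h3
  simpa using h3

/-- At a root of `x ^ 2 - x + 1` one has `1 - x = x⁻¹`. The symmetries `x ↦ 1 - x` and `x ↦ x⁻¹`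
of the Legendre polynomial then differ by the factor `(-x) ^ n`, where `-x` is a primitive cube
root of unity. -/
lemma choosePowSum_two_eq_zero (hn : 2 * n + 1 = p) (h3n : n % 3 = 2) {x : K}
    (hx : x ^ 2 - x = -1) : choosePowSum 2 n x = 0 := by
  have h3 : (3 : K) ≠ 0 := by
    intro h
    have : ((3 : ℕ) : K) = 0 := by exact_mod_cast h
    rw [CharP.cast_eq_zero_iff K p] at this
    have := Nat.le_of_dvd (by norm_num) this
    omega
  have hinv : x * (1 - x) = 1 := by linear_combination -hx
  have h4 := pow_mul_choosePowSum (m := 2) (n := n) hinv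
  have h5 := choosePowSum_two_one_sub hn x
  have hneg : ((-1) ^ n * (-1) ^ n : K) = 1 := by rw [← mul_pow]; simp
  have hxn : (-x) ^ n = x ^ n * (-1) ^ n := by rw [← mul_pow]; simp
  have h6 : ((-x) ^ n - 1) * choosePowSum 2 n x = 0 := by
    rw [hxn]
    linear_combination x ^ n * (-1) ^ n * h5 + x ^ n * choosePowSum 2 n (1 - x) * hneg + h4
  refine (mul_eq_zero.1 h6).resolve_left fun h ↦ ?_
  have hcube : (-x) ^ 3 = 1 := by linear_combination (-x - 1) * hx
  rw [← Nat.div_add_mod n 3, h3n, pow_add, pow_mul, hcube, one_pow, one_mul] at h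
  apply h3
  -- `x ^ 2 = 1` and `x ^ 2 - x = -1` force `x = 2`
  have h8 : x = 2 := by linear_combination h - hx
  rw [h8] at h
  linear_combination h

/-- Here the underlying Legendre polynomial is evaluated at a root of `x ^ 2 - x + 1`, which may
lie in a quadratic extension. -/
lemma choosePowSum_three_neg_four (hn : 2 * n + 1 = p) (h3n : n % 3 = 2) :
    choosePowSum 3 n (-4 : K) = 0 := by
  have := charP_of_injective_algebraMap (algebraMap K (AlgebraicClosure K)).injective p
  have h2 : (2 : AlgebraicClosure K) ≠ 0 := two_ne_zero_of_two_mul_add_one_eq hn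
  obtain ⟨s, hs⟩ := IsAlgClosed.exists_pow_nat_eq (-3 : AlgebraicClosure K) two_pos
  obtain ⟨x, hx⟩ : ∃ x : AlgebraicClosure K, x ^ 2 - x = -1 := by
    refine ⟨(1 + s) / 2, ?_⟩
    field_simp
    linear_combination hs
  have h8 := choosePowSum_three_eq_sq hn x
  rw [choosePowSum_two_eq_zero hn h3n hx, hx, mul_neg_one] at h8
  apply (algebraMap K (AlgebraicClosure K)).injective
  rw [map_choosePowSum, map_zero, map_neg, map_ofNat, h8]
  simp

lemma coeff_choosePowSum_X (m j : ℕ) (hm : m ≠ 0) :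
    (choosePowSum m n (X : K[X])).coeff j = (n.choose j : K) ^ m := by
  rw [choosePowSum, finsetSum_coeff]
  simp_rw [← C_eq_natCast, ← C_pow, coeff_C_mul_X_pow]
  simp +contextual
  intro h
  rw [Nat.choose_eq_zero_of_lt (by omega)]
  simp [hm]

lemma natDegree_choosePowSum_X (m : ℕ) (hm : m ≠ 0) :
    (choosePowSum m n (X : K[X])).natDegree = n := by
  refine natDegree_eq_of_le_of_coeff_ne_zero ?_ (by simp [coeff_choosePowSum_X, hm])
  rw [natDegree_le_iff_coeff_eq_zero]
  intro j hj
  rw [coeff_choosePowSum_X m j hm, Nat.choose_eq_zero_of_lt hj]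
  simp [hm]

lemma reverse_choosePowSum_X (m : ℕ) (hm : m ≠ 0) :
    (choosePowSum m n (X : K[X])).reverse = choosePowSum m n X := by
  ext j
  rw [coeff_reverse, natDegree_choosePowSum_X m hm, coeff_choosePowSum_X m _ hm,
    coeff_choosePowSum_X m _ hm]
  rcases le_or_gt j n with h | h
  · rw [revAt_le h, Nat.choose_symm h]
  · rw [revAt_eq_self_of_lt h]

/-- Clausen's identity exhibits the palindromic polynomial `∑ k, (n choose k) ^ 3 * V ^ k` as
`(1 + V) ^ e * r ^ 2`, so `r` is palindromic or antipalindromic. Its constant and leading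
coefficients are `1` and `(-2) ^ n = -1`, so it is antipalindromic, whence `r.eval 1 = 0`. -/
lemma choosePowSum_three_one (hn : 2 * n + 1 = p) (h2n : (-2 : K) ^ n = -1) :
    choosePowSum 3 n (1 : K) = 0 := by
  have h2 : (2 : K) ≠ 0 := two_ne_zero_of_two_mul_add_one_eq hn
  have ha : 2 * (2⁻¹ : K) = 1 := mul_inv_cancel₀ h2
  obtain ⟨h, hL, hF⟩ := exists_legendre_factor ha n
  have hb : 4 * ((2⁻¹ : K) ^ 2) = 1 := by field_simp; norm_num
  rw [map_clausenPoly_comp hn hb] at hF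
  set r := h.comp (X + C 1) with hr
  have hcube : choosePowSum 3 n (X : K[X]) = (X + C 1) ^ (n % 2) * r ^ 2 := by
    have := congrArg (compRingHom (X + C 1)) hF
    rw [map_choosePowSum] at this
    simpa [hr] using this
  have hne : (1 : K) ≠ -1 := fun h ↦ h2 (by linear_combination h)
  have hr0 : r.coeff 0 = 1 := by
    have := congrArg (eval 1) hL
    simp [expand_eval, ← coeff_zero_eq_eval_zero, coeff_shiftedLegendre] at this
    rw [coeff_zero_eq_eval_zero, hr, eval_comp]
    simpa using this.symm
  have hlead : r.leadingCoeff = -1 := by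
    have hLn : ((shiftedLegendre n).map (Int.castRingHom K)).coeff n = 1 := by
      rw [coeff_map, coeff_shiftedLegendre]
      simp [choose_add_eq (K := K) hn le_rfl, ← mul_pow]
    have hdeg : ((shiftedLegendre n).map (Int.castRingHom K)).natDegree = n := by
      refine natDegree_eq_of_le_of_coeff_ne_zero ?_ (by simp [hLn])
      exact natDegree_map_le.trans (natDegree_shiftedLegendre n).le
    have hlin : C (2⁻¹ : K) * (1 - X) = C (-2⁻¹) * X + C 2⁻¹ := by
      rw [C_neg]; ring
    have := congrArg leadingCoeff hL
    rw [hlin, leadingCoeff_comp (by rw [natDegree_linear (by simpa using h2)]; exact one_ne_zero),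
      leadingCoeff_linear (by simpa using h2), hdeg, leadingCoeff, hdeg, hLn, leadingCoeff_mul,
      leadingCoeff_expand two_pos, leadingCoeff_X_pow, one_mul, one_mul] at this
    rw [hr, leadingCoeff_comp (by rw [natDegree_X_add_C]; exact one_ne_zero),
      leadingCoeff_X_add_C, one_pow, mul_one, ← this, ← inv_neg, inv_pow, h2n]
    norm_num
  have hrev : r.reverse ^ 2 = r ^ 2 := by
    have h1 := reverse_choosePowSum_X (K := K) (n := n) 3 three_ne_zero
    have hX : (X + C 1 : K[X]).reverse = X + C 1 := by
      have h1 : (X : K[X]).reverse = C 1 := by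
        rw [← one_mul X, reverse_mul_X, ← C_1, reverse_C]
      rw [reverse_add_C, h1, natDegree_X, pow_one, C_1, one_mul, add_comm]
    have hpow : ((X + C 1 : K[X]) ^ (n % 2)).reverse = (X + C 1) ^ (n % 2) := by
      rcases Nat.mod_two_eq_zero_or_one n with h | h <;> rw [h]
      · rw [pow_zero, ← C_1, reverse_C]
      · rw [pow_one, hX]
    rw [hcube, reverse_mul_of_domain, hpow, pow_two r, reverse_mul_of_domain] at h1
    have := mul_left_cancel₀ (pow_ne_zero _ (X_add_C_ne_zero (1 : K))) h1
    rw [pow_two, pow_two, this]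
  have hanti : r.reverse = -r := by
    rcases sq_eq_sq_iff_eq_or_eq_neg.1 hrev with h1 | h1
    · exfalso
      have := congrArg (fun f ↦ f.coeff 0) h1
      simp only [coeff_zero_reverse, hlead, hr0] at this
      exact hne this.symm
    · exact h1
  have hroot : r.eval 1 = 0 := by
    have : Invertible (1 : K) := invertibleOne
    have h1 := eval₂_reverse_mul_pow (RingHom.id K) 1 r
    simp only [invOf_one, one_pow, mul_one, hanti, eval₂_id, eval_neg] at h1
    apply (mul_eq_zero.1 (_ : (2 : K) * _ = 0)).resolve_left h2
    linear_combination -h1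
  have := congrArg (evalRingHom 1) hcube
  rw [map_choosePowSum] at this
  simpa [hroot] using this

end

/-! ### Lifting to `p ^ 2` -/

lemma sixteen_pow_mul_choose {p n : ℕ} (hp : p.Prime) (hn : 2 * n + 1 = p) {k : ℕ} (hk : k ≤ n) :
    (16 : ZMod (p ^ 2)) ^ k * ((n + k).choose (2 * k) : ZMod (p ^ 2)) =
      (-1) ^ k * ((2 * k).choose k : ZMod (p ^ 2)) := by
  induction k with
  | zero => simp
  | succ k ih =>
    have h1 := congrArg (Int.cast (R := ZMod (p ^ 2))) (choose_add_two_mul_succ n k)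
    have h2 := congrArg (Int.cast (R := ZMod (p ^ 2))) (succ_mul_choose_two_mul_succ k)
    push_cast at h1 h2
    -- used through `4 (n + k + 1) (n - k) = (2 n + 1) ^ 2 - (2 k + 1) ^ 2`
    have hsq : (2 * (n : ZMod (p ^ 2)) + 1) ^ 2 = 0 := by
      have := ZMod.natCast_self (p ^ 2)
      rw [← hn] at this ⊢
      exact_mod_cast this
    have hunit : IsUnit ((2 * k + 1) * (2 * k + 2) : ZMod (p ^ 2)) := by
      have : ((2 * k + 1) * (2 * k + 2)).Coprime (p ^ 2) := by
        apply Nat.Coprime.pow_right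
        apply Nat.Coprime.mul_left
        · exact (hp.coprime_iff_not_dvd.2 (Nat.not_dvd_of_pos_of_lt (by omega) (by omega))).symm
        · exact (hp.coprime_iff_not_dvd.2 (Nat.not_dvd_of_pos_of_lt (by omega) (by omega))).symm
      have := (ZMod.isUnit_iff_coprime _ _).2 this
      exact_mod_cast this
    apply hunit.mul_left_cancel
    have ih := ih (by omega)
    linear_combination 16 ^ (k + 1) * h1 + 16 * (n + k + 1) * (n - k) * ih +
      4 * (-1) ^ k * ((2 * k).choose k : ZMod (p ^ 2)) * hsq +
      2 * (-1) ^ k * (2 * k + 1) * h2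

/-- The sum `∑ k, (2k choose k) ^ 3 / m ^ k` is, modulo `p ^ 2`, a unit times a square, so it
vanishes modulo `p ^ 2` as soon as it vanishes modulo `p`. -/
lemma sq_dvd_sum_choose_cube {p n : ℕ} (hp : p.Prime) (hn : 2 * n + 1 = p) {m : ℤ} {w : ZMod p}
    (hm : (m : ZMod p) ≠ 0) (hmw : (m : ZMod p) * w = -64) (hw : 1 + w ≠ 0)
    (h0 : choosePowSum 3 n w = 0) :
    ((p ^ 2 : ℕ) : ℤ) ∣ ∑ k ∈ Finset.range (n + 1), ((2 * k).choose k : ℤ) ^ 3 * m ^ (n - k) := by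
  have := Fact.mk hp
  let φ := ZMod.castHom (dvd_pow_self p two_ne_zero) (ZMod p)
  have hunit {a : ℤ} (ha : (a : ZMod p) ≠ 0) : ∃ b : ZMod (p ^ 2), (a : ZMod (p ^ 2)) * b = 1 := by
    have h1 : IsUnit (a : ZMod (p ^ 2)) := by
      rw [ZMod.coe_int_isUnit_iff_isCoprime]
      rw [Ne, ZMod.intCast_zmod_eq_zero_iff_dvd] at ha
      have : IsCoprime (p : ℤ) a :=
        (Prime.coprime_iff_not_dvd (Nat.prime_iff_prime_int.1 hp)).2 ha
      exact_mod_cast this.pow_left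
    exact h1.exists_right_inv
  have h2 : (2 : ZMod p) ≠ 0 := two_ne_zero_of_two_mul_add_one_eq hn
  obtain ⟨a, ha⟩ := hunit (a := 2) (by exact_mod_cast h2)
  obtain ⟨μ, hμ⟩ := hunit hm
  have ha : 2 * a = 1 := by exact_mod_cast ha
  obtain ⟨h, -, hF⟩ := exists_legendre_factor ha n
  set u : ZMod (p ^ 2) := 1 - 64 * μ with hu
  set x : ZMod (p ^ 2) := -16 * μ with hx
  have hsum : ∑ k ∈ Finset.range (n + 1), (clausenCoeff n k : ZMod (p ^ 2)) * x ^ k =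
      u ^ (n % 2) * h.eval u ^ 2 := by
    have := congrArg (eval u) hF
    rw [clausenPoly, Polynomial.map_sum, eval_comp, eval_finsetSum] at this
    simp only [eval_mul, eval_pow, eval_C, eval_sub, eval_X, eval_one, Polynomial.map_mul,
      Polynomial.map_pow, map_C, map_X, Int.coe_castRingHom] at this
    have hxu : a ^ 2 * (u - 1) = x := by
      rw [hu, hx]
      linear_combination (-16 * μ) * (2 * a + 1) * ha
    rw [← this, hxu]
  have hφw : 4 * φ x = w := by
    have h3 : (m : ZMod p) * φ μ = 1 := by
      have := congrArg φ hμ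
      simpa using this
    apply mul_left_cancel₀ hm
    rw [hmw, hx]
    simp only [map_mul, map_neg, map_ofNat]
    linear_combination (-64) * h3
  have hφ : φ u ^ (n % 2) * φ (h.eval u) ^ 2 = 0 := by
    rw [← map_pow, ← map_pow, ← map_mul, ← hsum, map_sum, ← h0, choosePowSum]
    refine Finset.sum_congr rfl fun k hk ↦ ?_
    have := clausenCoeff_eq (K := ZMod p) hn (Nat.lt_succ_iff.1 (Finset.mem_range.1 hk))
    rw [map_mul, map_pow, map_intCast, this, ← hφw, mul_pow]
    ring
  have hφu : φ u ≠ 0 := by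
    have : φ u = 1 + w := by
      rw [← hφw, hu, hx]
      simp only [map_mul, map_neg, map_ofNat, map_sub, map_one]
      ring
    rwa [this]
  have hφh : φ (h.eval u) = 0 := by
    simpa using (mul_eq_zero.1 hφ).resolve_left (pow_ne_zero _ hφu)
  have hsq : h.eval u ^ 2 = 0 := by
    obtain ⟨z, hz⟩ := ZMod.intCast_surjective (h.eval u)
    rw [← hz, map_intCast, ZMod.intCast_zmod_eq_zero_iff_dvd] at hφh
    rw [← hz, ← Int.cast_pow, ZMod.intCast_zmod_eq_zero_iff_dvd]
    push_cast
    exact pow_dvd_pow_of_dvd hφh 2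
  rw [← ZMod.intCast_zmod_eq_zero_iff_dvd]
  push_cast
  rw [hsq, mul_zero] at hsum
  rw [← mul_zero ((m : ZMod (p ^ 2)) ^ n), ← hsum, Finset.mul_sum]
  refine Finset.sum_congr rfl fun k hk ↦ ?_
  have hk : k ≤ n := Nat.lt_succ_iff.1 (Finset.mem_range.1 hk)
  have h16 := sixteen_pow_mul_choose hp hn hk
  have hmk : (m : ZMod (p ^ 2)) ^ k * μ ^ k = 1 := by rw [← mul_pow, hμ, one_pow]
  have hneg : ((-1) ^ k * (-1) ^ k : ZMod (p ^ 2)) = 1 := by rw [← mul_pow]; simp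
  have hxk : x ^ k = (-1) ^ k * 16 ^ k * μ ^ k := by
    rw [hx, ← mul_pow, ← mul_pow]; ring
  rw [hxk, clausenCoeff]
  rw [show (m : ZMod (p ^ 2)) ^ n = m ^ (n - k) * m ^ k by rw [← pow_add, Nat.sub_add_cancel hk]]
  push_cast
  set b := ((2 * k).choose k : ZMod (p ^ 2))
  set c := ((n + k).choose (2 * k) : ZMod (p ^ 2))
  linear_combination (-(m : ZMod (p ^ 2)) ^ (n - k) * b ^ 2 * (-1) ^ k) * h16 -
    (m : ZMod (p ^ 2)) ^ (n - k) * b ^ 3 * hneg -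
    (m : ZMod (p ^ 2)) ^ (n - k) * b ^ 2 * c * (-1) ^ k * 16 ^ k * hmk

lemma ratModEq_sum_of_dvd {p n : ℕ} (hp : p.Prime) {m : ℤ} (hm : ¬ (p : ℤ) ∣ m)
    (h : ((p ^ 2 : ℕ) : ℤ) ∣
      ∑ k ∈ Finset.range (n + 1), ((2 * k).choose k : ℤ) ^ 3 * m ^ (n - k)) :
    RatModEq (p ^ 2)
      (∑ k ∈ Finset.range (n + 1), (Nat.choose (2 * k) k : ℚ) ^ 3 / (m : ℚ) ^ k) 0 := by
  obtain ⟨t, ht⟩ := h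
  have hm0 : (m : ℚ) ≠ 0 := by
    rintro h
    exact hm (by rw [Int.cast_eq_zero.1 h]; exact dvd_zero _)
  refine ⟨(t : ℚ) / ((m ^ n : ℤ) : ℚ), ?_, ?_⟩
  · apply Nat.Coprime.pow_right
    rw [Nat.coprime_comm, hp.coprime_iff_not_dvd]
    intro hd
    have h1 : (p : ℤ) ∣ m ^ n := (Int.natCast_dvd_natCast.2 hd).trans (by
      rw [← Rat.divInt_eq_div]; exact Rat.den_dvd t (m ^ n))
    exact hm ((Nat.prime_iff_prime_int.1 hp).dvd_of_dvd_pow h1)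
  · have h1 := congrArg (Int.cast (R := ℚ)) ht
    push_cast at h1 ⊢
    rw [sub_zero, ← mul_div_assoc, ← h1, Finset.sum_div]
    refine Finset.sum_congr rfl fun k hk ↦ ?_
    have hk : k ≤ n := Nat.lt_succ_iff.1 (Finset.mem_range.1 hk)
    rw [show (m : ℚ) ^ n = m ^ (n - k) * m ^ k by rw [← pow_add, Nat.sub_add_cancel hk]]
    field_simp

lemma ratModEq_sum {p n : ℕ} (hp : p.Prime) (hn : 2 * n + 1 = p) {m : ℤ} {w : ZMod p}
    (hm : (m : ZMod p) ≠ 0) (hmw : (m : ZMod p) * w = -64) (hw : 1 + w ≠ 0)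
    (h0 : choosePowSum 3 n w = 0) :
    RatModEq (p ^ 2)
      (∑ k ∈ Finset.range (n + 1), (Nat.choose (2 * k) k : ℚ) ^ 3 / (m : ℚ) ^ k) 0 :=
  ratModEq_sum_of_dvd hp (by rwa [Ne, ZMod.intCast_zmod_eq_zero_iff_dvd] at hm)
    (sq_dvd_sum_choose_cube hp hn hm hmw hw h0)

theorem theorem3p4 (p : ℕ) (hp : p.Prime) (hodd : Odd p) :
    (p % 4 = 3 →
      RatModEq (p ^ 2)
        (∑ k ∈ Finset.range ((p - 1) / 2 + 1), (Nat.choose (2 * k) k : ℚ) ^ 3 / (-512 : ℚ) ^ k) 0) ∧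
    (p % 8 = 5 ∨ p % 8 = 7 →
      RatModEq (p ^ 2)
        (∑ k ∈ Finset.range ((p - 1) / 2 + 1), (Nat.choose (2 * k) k : ℚ) ^ 3 / (-64 : ℚ) ^ k) 0) ∧
    (p % 3 = 2 →
      RatModEq (p ^ 2)
        (∑ k ∈ Finset.range ((p - 1) / 2 + 1), (Nat.choose (2 * k) k : ℚ) ^ 3 / (16 : ℚ) ^ k) 0 ∧
      RatModEq (p ^ 2)
        (∑ k ∈ Finset.range ((p - 1) / 2 + 1), (Nat.choose (2 * k) k : ℚ) ^ 3 / (256 : ℚ) ^ k) 0) := by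
  have := Fact.mk hp
  obtain ⟨n, hn⟩ := hodd
  have hn : 2 * n + 1 = p := hn.symm
  rw [show (p - 1) / 2 = n by omega]
  have h2 : (2 : ZMod p) ≠ 0 := two_ne_zero_of_two_mul_add_one_eq hn
  have h3 (hp3 : p ≠ 3) : (3 : ZMod p) ≠ 0 := by
    intro h
    have : ((3 : ℕ) : ZMod p) = 0 := by exact_mod_cast h
    rw [ZMod.natCast_eq_zero_iff, Nat.prime_dvd_prime_iff_eq hp Nat.prime_three] at this
    exact hp3 this
  refine ⟨fun h ↦ ?_, fun h ↦ ?_, fun h ↦ ⟨?_, ?_⟩⟩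
  · -- for `p = 3` the argument `u = 9 / 8` is not a unit, but the sum is `1 - 8 / 512 = 63 / 64`
    rcases eq_or_ne p 3 with rfl | hp3
    · obtain rfl : n = 1 := by omega
      have := ratModEq_sum_of_dvd (n := 1) (m := -512) hp (by norm_num)
        (by norm_num [Finset.sum_range_succ])
      simpa only [Int.cast_neg, Int.cast_ofNat] using this
    · have hv : (8 : ZMod p) * 8⁻¹ = 1 :=
        mul_inv_cancel₀ (by rw [show (8 : ZMod p) = 2 ^ 3 by norm_num]; exact pow_ne_zero _ h2)
      have := ratModEq_sum (m := -512) (w := 8⁻¹) hp hn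
        (by push_cast; rw [show (-512 : ZMod p) = -2 ^ 9 by norm_num]
            exact neg_ne_zero.2 (pow_ne_zero _ h2))
        (by push_cast; linear_combination (-64) * hv)
        (fun h9 ↦ pow_ne_zero 2 (h3 hp3) (by linear_combination 8 * h9 - hv))
        (by
          rw [← pow_mul_choosePowSum (w := 8⁻¹) (v := 8) (by rw [mul_comm, hv]),
            choosePowSum_three_eight hn (Nat.odd_iff.2 (by omega)), mul_zero])
      simpa only [Int.cast_neg, Int.cast_ofNat] using this
  · have h2n : (-2 : ZMod p) ^ n = -1 := by
      have h4 : ¬ IsSquare (-2 : ZMod p) := by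
        rw [ZMod.exists_sq_eq_neg_two_iff (by omega)]
        omega
      rw [ZMod.euler_criterion p (neg_ne_zero.2 h2), show p / 2 = n by omega] at h4
      have := ZMod.pow_div_two_eq_neg_one_or_one p (neg_ne_zero.2 h2)
      rw [show p / 2 = n by omega] at this
      exact this.resolve_left h4
    have := ratModEq_sum (m := -64) (w := 1) hp hn
      (by push_cast; rw [show (-64 : ZMod p) = -2 ^ 6 by norm_num]
          exact neg_ne_zero.2 (pow_ne_zero _ h2))
      (by push_cast; ring) (fun h ↦ h2 (by linear_combination h))
      (choosePowSum_three_one hn h2n)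
    simpa only [Int.cast_neg, Int.cast_ofNat] using this
  · have := ratModEq_sum (m := 16) (w := -4) hp hn
      (by push_cast; rw [show (16 : ZMod p) = 2 ^ 4 by norm_num]; exact pow_ne_zero _ h2)
      (by push_cast; ring) (fun h4 ↦ h3 (by omega) (by linear_combination -h4))
      (choosePowSum_three_neg_four hn (by omega))
    simpa only [Int.cast_neg, Int.cast_ofNat] using this
  · have hv : (4 : ZMod p) * 4⁻¹ = 1 :=
      mul_inv_cancel₀ (by rw [show (4 : ZMod p) = 2 ^ 2 by norm_num]; exact pow_ne_zero _ h2)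
    have := ratModEq_sum (m := 256) (w := -4⁻¹) hp hn
      (by push_cast; rw [show (256 : ZMod p) = 2 ^ 8 by norm_num]; exact pow_ne_zero _ h2)
      (by push_cast; linear_combination (-64) * hv)
      (fun h4 ↦ h3 (by omega) (by linear_combination 4 * h4 + hv))
      (by
        rw [← pow_mul_choosePowSum (w := -4⁻¹) (v := -4) (by linear_combination hv),
          choosePowSum_three_neg_four hn (by omega), mul_zero])
    simpa only [Int.cast_neg, Int.cast_ofNat] using this
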